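/- Let $n\ge 2$. For $z\in\mathbb C^n$ let $\mathbf s(z)=(s_1(z),\dots,s_n(z))$ be the vector of elementary symmetric polynomials, $\Gamma_n=\mathbf s(\overline{\mathbb D}^n)$ and $b\Gamma_n=\mathbf s(\mathbb T^n)$. A commuting tuple $(S_1,\dots,S_n)$ of bounded operators on a complex Hilbert space is a *$\Gamma_n$-contraction* if $\Gamma_n$ is a spectral set for it, i.e. its (Taylor) joint spectrum lies in $\Gamma_n$ and there is a unital algebra homomorphism $\rho$, with $z_i\mapsto S_i$, from the algebra of functions holomorphic near $\Gamma_n$ to the bounded operators such that $\|\rho(f)\|\le\sup_{\Gamma_n}|f|$ for all $f$; in particular $\|S_n\|\le 1$. A commuting tuple of normal operators whose joint spectrum lies in $b\Gamma_n$ is a *$\Gamma_n$-unitary*. Let $(S_1,\dots,S_n)$ be a $\Gamma_n$-contraction on $\mathcal H$, and let $\mathcal P_{S_n^*}$ be the positive operator on $\mathcal H$ with $\mathcal P_{S_n^*}^2=\mathrm{SOT}\text{-}\lim_k S_n^kS_n^{*k}$. The formulas $$\mathcal P_{S_n^*}h\mapsto \mathcal P_{S_n^*}S_i^*h\qquad(h\in\mathcal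 H,\ 1\le i\le n)$$ extend to well-defined bounded operators $A_1,\dots,A_n$ on $\overline{\mathrm{Ran}}\,\mathcal P_{S_n^*}$, and $A_n$ is an isometry. A *canonical $\Gamma_n$-unitary* associated with $(S_1,\dots,S_n)$ is a $\Gamma_n$-unitary $(D_1,\dots,D_n)$ on a Hilbert space $\mathscr P_{S_n^*}$ containing $\overline{\mathrm{Ran}}\,\mathcal P_{S_n^*}$ (through an isometric embedding) as a closed subspace, such that $D_i^*$ extends $A_i$ for $i=1,\dots,n$ and $D_n^*$ is the minimal unitary extension of $A_n$, i.e. $D_n^*$ is unitary and $\mathscr P_{S_n^*}$ is the smallest closed subspace that contains $\overline{\mathrm{Ran}}\,\mathcal P_{S_n^*}$ and reduces $D_n^*$. **Theorem.** Let $(D_1,\dots,D_n)$ on $\mathscr P_{S_n^*}$ and $(D_1',\dots,D_n')$ on $\mathscr P_{S_n'^*}$ be canonical $\Gamma_n$-unitaries associated with $\Gamma_n$-contractions $(S_1,\dots,S_n)$ on $\mathcal H$ and $(S_1',\dots,S_n')$ on $\mathcal H'$, respectively. Suppose that $U:\mathcal H\to\mathcal H'$ is a unitary operator with $US_i=S_i'U$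 for $i=1,\dots,n$. Then there is a unitary operator $U_D:\mathscr P_{S_n^*}\to\mathscr P_{S_n'^*}$ with $$U_D\bigl(D_n^k\,\mathcal P_{S_n^*}h\bigr)=D_n'^k\,\mathcal P_{S_n'^*}Uh\qquad\text{for all }k\ge 0,\ h\in\mathcal H,$$ it is the only bounded linear operator satisfying this formula, and $U_DD_i=D_i'U_D$ for $i=1,\dots,n$. -/

import Mathlib

open Filter Topology
open scoped InnerProduct

noncomputable section

namespace GammaN

/-! ### The symmetrized polydisc -/

/-- The symmetrization map `(z₁, …, zₙ) ↦ (s₁(z), …, sₙ(z))`; the coordinate with (zero-based) index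
`i` is the elementary symmetric polynomial of degree `i + 1`. -/
def symmetrization (n : ℕ) (z : Fin n → ℂ) : Fin n → ℂ := fun i =>
  ∑ t ∈ Finset.powersetCard (i.val + 1) (Finset.univ : Finset (Fin n)), ∏ j ∈ t, z j

/-- The closed symmetrized polydisc `Γₙ`. -/
def Gam (n : ℕ) : Set (Fin n → ℂ) :=
  symmetrization n '' {z | ∀ j, ‖z j‖ ≤ 1}

/-- The distinguished boundary `bΓₙ`. -/
def bGam (n : ℕ) : Set (Fin n → ℂ) :=
  symmetrization n '' {z | ∀ j, ‖z j‖ = 1}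

/-! ### The joint (Taylor) spectrum -/

section Spectrum

variable {n : ℕ} {H : Type*} [NormedAddCommGroup H] [InnerProductSpace ℂ H]

/-- The differential of the (total) Koszul complex `Λ(ℂⁿ) ⊗ H` of a tuple `T`. An element of
`Λ(ℂⁿ) ⊗ H` is written as `∑ₛ eₛ ⊗ x s` with `s` running over the subsets of the index set, and the
differential is `e ⊗ x ↦ ∑ᵢ (eᵢ ∧ e) ⊗ Tᵢ x`. -/
def koszulDifferential (T : Fin n → H →L[ℂ] H) (x : Finset (Fin n) → H) : Finset (Fin n) → H :=
  fun s => ∑ i ∈ s, ((-1 : ℂ) ^ (s.filter (fun j => j < i)).card) • T i (x (s.erase i))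

/-- The Taylor joint spectrum of a commuting tuple: the points `l` for which the Koszul complex of
`(T₁ - l₁, …, Tₙ - lₙ)` is not exact. -/
def jointSpectrum (T : Fin n → H →L[ℂ] H) : Set (Fin n → ℂ) :=
  {l | ¬ ∀ x : Finset (Fin n) → H,
      koszulDifferential (fun i => T i - l i • ContinuousLinearMap.id ℂ H) x = 0 →
        ∃ y : Finset (Fin n) → H,
          koszulDifferential (fun i => T i - l i • ContinuousLinearMap.id ℂ H) y = x}

end Spectrum

/-! ### Spectral sets -/

/-- The algebra `𝒪(Ω)` of functions that are holomorphic in some neighbourhood of `Ω`. -/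
def holomorphicNear {n : ℕ} (Ω : Set (Fin n → ℂ)) : Subalgebra ℂ ((Fin n → ℂ) → ℂ) where
  carrier := {f | ∃ V : Set (Fin n → ℂ), IsOpen V ∧ Ω ⊆ V ∧ DifferentiableOn ℂ f V}
  mul_mem' := by
    rintro f g ⟨V, hV, hΩV, hf⟩ ⟨W, hW, hΩW, hg⟩
    exact ⟨V ∩ W, hV.inter hW, Set.subset_inter hΩV hΩW,
      (hf.mono Set.inter_subset_left).mul (hg.mono Set.inter_subset_right)⟩
  add_mem' := by
    rintro f g ⟨V, hV, hΩV, hf⟩ ⟨W, hW, hΩW, hg⟩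
    exact ⟨V ∩ W, hV.inter hW, Set.subset_inter hΩV hΩW,
      (hf.mono Set.inter_subset_left).add (hg.mono Set.inter_subset_right)⟩
  algebraMap_mem' := by
    intro c
    exact ⟨Set.univ, isOpen_univ, Set.subset_univ _, differentiableOn_const c⟩

/-- The coordinate function `zᵢ` as an element of `𝒪(Ω)`. -/
def coordinate {n : ℕ} (Ω : Set (Fin n → ℂ)) (i : Fin n) : holomorphicNear Ω :=
  ⟨fun z => z i, Set.univ, isOpen_univ, Set.subset_univ _, by fun_prop⟩

variable {n : ℕ}
variable {H : Type*} [NormedAddCommGroup H] [InnerProductSpace ℂ H] [CompleteSpace H]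
variable {K : Type*} [NormedAddCommGroup K] [InnerProductSpace ℂ K] [CompleteSpace K]

/-- The compact set `Ω` is a spectral set for the commuting tuple `T`: the joint spectrum lies in
`Ω`, and there is a unital homomorphism `𝒪(Ω) → ℬ(H)` with `zᵢ ↦ Tᵢ` that is contractive for the
supremum norm over `Ω` on `𝒪(Ω)`. -/
structure IsSpectralSet (Ω : Set (Fin n → ℂ)) (T : Fin n → H →L[ℂ] H) : Prop where
  spectrum_subset : jointSpectrum T ⊆ Ω
  exists_contractive_hom : ∃ ρ : holomorphicNear Ω →ₐ[ℂ] (H →L[ℂ] H),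
    (∀ i, ρ (coordinate Ω i) = T i) ∧
    ∀ (f : holomorphicNear Ω) (C : ℝ), 0 ≤ C → (∀ z ∈ Ω, ‖f.1 z‖ ≤ C) → ‖ρ f‖ ≤ C

/-- `Γₙ`-contractions. -/
structure IsGammaContraction (S : Fin n → H →L[ℂ] H) : Prop where
  commute : ∀ i j, Commute (S i) (S j)
  isSpectralSet : IsSpectralSet (Gam n) S

/-- `Γₙ`-unitaries. -/
structure IsGammaUnitary (D : Fin n → K →L[ℂ] K) : Prop where
  commute : ∀ i j, Commute (D i) (D j)
  normal : ∀ i, IsStarNormal (D i)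
  spectrum_subset : jointSpectrum D ⊆ bGam n

/-- The last index of an `n`-tuple. -/
def lastIdx (n : ℕ) (hn : 2 ≤ n) : Fin n := ⟨n - 1, by omega⟩

/-- The last operator of a `Γₙ`-contraction is a contraction. -/
theorem IsGammaContraction.norm_last_le_one {S : Fin n → H →L[ℂ] H} (hS : IsGammaContraction S)
    (hn : 2 ≤ n) : ‖S (lastIdx n hn)‖ ≤ 1 := by
  obtain ⟨ρ, hρ, hb⟩ := hS.isSpectralSet.exists_contractive_hom
  rw [← hρ]
  refine hb _ 1 zero_le_one ?_
  rintro _ ⟨z, hz, rfl⟩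
  have h1 : (lastIdx n hn).val + 1 = (Finset.univ : Finset (Fin n)).card := by
    simp only [lastIdx, Finset.card_univ, Fintype.card_fin]; omega
  have h2 : (coordinate (Gam n) (lastIdx n hn)).1 (symmetrization n z) = ∏ j, z j := by
    change symmetrization n z (lastIdx n hn) = _
    simp only [symmetrization, h1, Finset.powersetCard_self, Finset.sum_singleton]
  rw [h2, norm_prod]
  exact Finset.prod_le_one (fun _ _ => norm_nonneg _) (fun j _ => hz j)

/-! ### The operator `𝒫` of a contraction -/

/-- For a contraction `T` the sequence `T ^ k (T*) ^ k` converges strongly, and the limit is the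
square of a positive operator. -/
theorem exists_asymptoticRoot (T : H →L[ℂ] H) (hT : ‖T‖ ≤ 1) :
    ∃ P : H →L[ℂ] H, P.IsPositive ∧
      ∀ h, Tendsto (fun k : ℕ => (T ^ k * (ContinuousLinearMap.adjoint T) ^ k) h) atTop
        (𝓝 (P (P h))) := by
  set B := ContinuousLinearMap.adjoint T with hB
  have hBn : ‖B‖ ≤ 1 := by rw [hB, LinearIsometryEquiv.norm_map]; exact hT
  have hTB : ∀ k : ℕ, T ^ k = ContinuousLinearMap.adjoint (B ^ k) := by
    intro k
    rw [← ContinuousLinearMap.star_eq_adjoint, star_pow, ContinuousLinearMap.star_eq_adjoint, hB,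
      ContinuousLinearMap.adjoint_adjoint]
  have hpow : ∀ k : ℕ, ‖T ^ k‖ ≤ 1 := by
    intro k
    induction k with
    | zero => rw [pow_zero]; exact ContinuousLinearMap.norm_id_le
    | succ k ih =>
      rw [pow_succ]
      exact (norm_mul_le _ _).trans (mul_le_one₀ ih (norm_nonneg _) hT)
  -- the quadratic form of `T ^ k B ^ k`
  have hq : ∀ (k : ℕ) (x y : H), inner ℂ ((T ^ k * B ^ k) x) y = inner ℂ ((B ^ k) x) ((B ^ k) y) := by
    intro k x y
    rw [hTB k, mul_apply_eq_comp, ContinuousLinearMap.adjoint_inner_left]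
  have hanti : ∀ x : H, Antitone (fun k : ℕ => ‖(B ^ k) x‖ ^ 2) := by
    intro x
    refine antitone_nat_of_succ_le fun k => ?_
    have : ‖(B ^ (k + 1)) x‖ ≤ ‖(B ^ k) x‖ := by
      rw [pow_succ', mul_apply_eq_comp]
      exact (B.le_of_opNorm_le hBn _).trans (by simp)
    gcongr
  -- differences `‖T ^ k B ^ k x - T ^ l B ^ l x‖ ^ 2` are controlled by the quadratic form
  have hdiff : ∀ (k m : ℕ) (x : H),
      ‖(T ^ k * B ^ k) x - (T ^ (k + m) * B ^ (k + m)) x‖ ^ 2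
        ≤ ‖(B ^ k) x‖ ^ 2 - ‖(B ^ (k + m)) x‖ ^ 2 := by
    intro k m x
    set u := (B ^ k) x with hu
    have hv : (B ^ (k + m)) x = (B ^ m) u := by
      rw [add_comm, pow_add, mul_apply_eq_comp]
    have e1 : (T ^ k * B ^ k) x - (T ^ (k + m) * B ^ (k + m)) x
        = (T ^ k) (u - (T ^ m * B ^ m) u) := by
      rw [mul_apply_eq_comp, mul_apply_eq_comp, hv, pow_add,
        mul_apply_eq_comp, map_sub, mul_apply_eq_comp]
    have e2 : ‖(T ^ k) (u - (T ^ m * B ^ m) u)‖ ≤ ‖u - (T ^ m * B ^ m) u‖ := by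
      simpa using (T ^ k).le_of_opNorm_le (hpow k) (u - (T ^ m * B ^ m) u)
    have e3 : ‖(T ^ m * B ^ m) u‖ ≤ ‖(B ^ m) u‖ := by
      simpa using (T ^ m).le_of_opNorm_le (hpow m) ((B ^ m) u)
    have e4 : RCLike.re (inner ℂ u ((T ^ m * B ^ m) u)) = ‖(B ^ m) u‖ ^ 2 := by
      rw [← inner_conj_symm, RCLike.conj_re, hq]
      exact inner_self_eq_norm_sq _
    have e5 := norm_sub_sq (𝕜 := ℂ) u ((T ^ m * B ^ m) u)
    rw [e4] at e5
    have e6 : ‖(T ^ m * B ^ m) u‖ ^ 2 ≤ ‖(B ^ m) u‖ ^ 2 := by gcongr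
    rw [e1, hv]
    calc ‖(T ^ k) (u - (T ^ m * B ^ m) u)‖ ^ 2 ≤ ‖u - (T ^ m * B ^ m) u‖ ^ 2 := by gcongr
      _ ≤ ‖u‖ ^ 2 - ‖(B ^ m) u‖ ^ 2 := by rw [e5]; linarith
  have hcauchy : ∀ x : H, CauchySeq (fun k : ℕ => (T ^ k * B ^ k) x) := by
    intro x
    have hlim := tendsto_atTop_ciInf (hanti x) ⟨0, by rintro _ ⟨k, rfl⟩; positivity⟩
    have hc := hlim.cauchySeq
    rw [Metric.cauchySeq_iff'] at hc ⊢
    intro ε hε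
    obtain ⟨N, hN⟩ := hc (ε ^ 2) (by positivity)
    refine ⟨N, fun k hk => ?_⟩
    obtain ⟨m, rfl⟩ := Nat.exists_eq_add_of_le hk
    have h1 := hN (N + m) (by omega)
    rw [Real.dist_eq, abs_lt] at h1
    rw [dist_comm, dist_eq_norm]
    refine lt_of_pow_lt_pow_left₀ 2 hε.le ((hdiff N m x).trans_lt ?_)
    linarith [h1.1]
  choose a ha using fun x : H => cauchySeq_tendsto_of_complete (hcauchy x)
  let A : H →L[ℂ] H := continuousLinearMapOfTendsto (fun k : ℕ => T ^ k * B ^ k)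
    (tendsto_pi_nhds.mpr ha)
  have hA : ∀ x, A x = a x := fun x => rfl
  have hApos : A.IsPositive := by
    rw [ContinuousLinearMap.isPositive_iff_complex]
    intro x
    have hin : Tendsto (fun k : ℕ => inner ℂ ((T ^ k * B ^ k) x) x) atTop (𝓝 (inner ℂ (A x) x)) :=
      (ha x).inner tendsto_const_nhds
    have hval : ∀ k : ℕ, inner ℂ ((T ^ k * B ^ k) x) x = ((‖(B ^ k) x‖ ^ 2 : ℝ) : ℂ) := by
      intro k
      rw [hq, inner_self_eq_norm_sq_to_K]
      push_cast
      rfl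
    simp only [hval] at hin
    have hre := (Complex.continuous_re.tendsto _).comp hin
    have him := (Complex.continuous_im.tendsto _).comp hin
    have him0 : (inner ℂ (A x) x : ℂ).im = 0 := by
      refine tendsto_nhds_unique him ?_
      simp only [Function.comp_def, Complex.ofReal_im]
      exact tendsto_const_nhds
    have hre0 : 0 ≤ (inner ℂ (A x) x : ℂ).re := by
      refine ge_of_tendsto' hre fun k => ?_
      simp only [Function.comp_def, Complex.ofReal_re]
      positivity
    refine ⟨?_, hre0⟩
    apply Complex.ext
    · simp
    · simp [him0]
  have hA0 : 0 ≤ A := (ContinuousLinearMap.nonneg_iff_isPositive A).mpr hApos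
  refine ⟨CFC.sqrt A, (ContinuousLinearMap.nonneg_iff_isPositive _).mp (CFC.sqrt_nonneg A), ?_⟩
  intro h
  have h1 : CFC.sqrt A (CFC.sqrt A h) = A h := by
    rw [← mul_apply_eq_comp, CFC.sqrt_mul_sqrt_self A hA0]
  rw [h1]
  exact ha h

open Classical in
/-- The positive operator `𝒫` with `𝒫² = SOT-lim T ^ k (T*) ^ k`. It exists for every contraction,
and it is unique because positive square roots are; the value for other `T` is irrelevant. -/
def asymptoticRoot (T : H →L[ℂ] H) : H →L[ℂ] H :=
  if hP : ∃ P : H →L[ℂ] H, P.IsPositive ∧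
      ∀ h, Tendsto (fun k : ℕ => (T ^ k * (ContinuousLinearMap.adjoint T) ^ k) h) atTop
        (𝓝 (P (P h)))
  then hP.choose else 0

theorem asymptoticRoot_spec (T : H →L[ℂ] H) (hT : ‖T‖ ≤ 1) :
    (asymptoticRoot T).IsPositive ∧
      ∀ h, Tendsto (fun k : ℕ => (T ^ k * (ContinuousLinearMap.adjoint T) ^ k) h) atTop
        (𝓝 (asymptoticRoot T (asymptoticRoot T h))) := by
  have hP := exists_asymptoticRoot T hT
  rw [asymptoticRoot, dif_pos hP]
  exact hP.choose_spec

/-- The Hilbert space `closure (Ran 𝒫)`. -/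
abbrev asymptoticSpace (T : H →L[ℂ] H) : Submodule ℂ H :=
  (LinearMap.range (asymptoticRoot T).toLinearMap).topologicalClosure

/-- `𝒫`, regarded as an operator into `closure (Ran 𝒫)`. -/
def toAsymptoticSpace (T : H →L[ℂ] H) : H →L[ℂ] asymptoticSpace T :=
  (asymptoticRoot T).codRestrict (asymptoticSpace T)
    (fun h => Submodule.le_topologicalClosure _ (LinearMap.mem_range_self _ h))

theorem denseRange_toAsymptoticSpace (T : H →L[ℂ] H) : DenseRange (toAsymptoticSpace T) := by
  rw [DenseRange, Subtype.dense_iff]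
  intro x hx
  rw [← Set.range_comp]
  exact hx

/-- The bounded operator on `closure (Ran 𝒫)`, `𝒫` being formed from `T`, that is densely defined by
`𝒫 h ↦ 𝒫 (A* h)`. -/
def inducedAdjoint (T A : H →L[ℂ] H) : asymptoticSpace T →L[ℂ] asymptoticSpace T :=
  LinearMap.extendOfNorm
    ((toAsymptoticSpace T).comp (ContinuousLinearMap.adjoint A)).toLinearMap
    (toAsymptoticSpace T).toLinearMap

/-- If `A` commutes with the contraction `T`, the induced operator really is well defined, bounded,
and given by its defining formula. -/
theorem inducedAdjoint_apply (T A : H →L[ℂ] H) (hT : ‖T‖ ≤ 1) (hA : Commute A T) (h : H) :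
    inducedAdjoint T A (toAsymptoticSpace T h)
      = toAsymptoticSpace T (ContinuousLinearMap.adjoint A h) := by
  obtain ⟨hpos, hlim⟩ := asymptoticRoot_spec T hT
  have hnorm : ∀ x : H, Tendsto (fun k : ℕ => ‖((ContinuousLinearMap.adjoint T) ^ k) x‖ ^ 2) atTop
      (𝓝 (‖asymptoticRoot T x‖ ^ 2)) := by
    intro x
    have h1 : Tendsto (fun k : ℕ => RCLike.re (inner ℂ
        ((T ^ k * (ContinuousLinearMap.adjoint T) ^ k) x) x)) atTop
        (𝓝 (RCLike.re (inner ℂ (asymptoticRoot T (asymptoticRoot T x)) x))) :=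
      (RCLike.continuous_re.tendsto _).comp ((hlim x).inner tendsto_const_nhds)
    have h2 : RCLike.re (inner ℂ (asymptoticRoot T (asymptoticRoot T x)) x)
        = ‖asymptoticRoot T x‖ ^ 2 := by
      rw [hpos.inner_left_eq_inner_right]
      exact inner_self_eq_norm_sq (𝕜 := ℂ) _
    rw [h2] at h1
    refine h1.congr fun k => ?_
    have h3 : T ^ k = ContinuousLinearMap.adjoint ((ContinuousLinearMap.adjoint T) ^ k) := by
      rw [← ContinuousLinearMap.star_eq_adjoint, star_pow, ContinuousLinearMap.star_eq_adjoint,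
        ContinuousLinearMap.adjoint_adjoint]
    conv_lhs => rw [h3]
    rw [mul_apply_eq_comp, ContinuousLinearMap.adjoint_inner_left]
    exact inner_self_eq_norm_sq (𝕜 := ℂ) _
  have hcomm : ∀ (k : ℕ) (x : H), ((ContinuousLinearMap.adjoint T) ^ k)
      (ContinuousLinearMap.adjoint A x)
        = ContinuousLinearMap.adjoint A (((ContinuousLinearMap.adjoint T) ^ k) x) := by
    intro k x
    have h1 : Commute (ContinuousLinearMap.adjoint A) (ContinuousLinearMap.adjoint T) := by
      rw [← ContinuousLinearMap.star_eq_adjoint, ← ContinuousLinearMap.star_eq_adjoint]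
      exact hA.star_star
    rw [← mul_apply_eq_comp, ← mul_apply_eq_comp, (h1.pow_right k).eq]
  have hbound : ∀ x : H, ‖asymptoticRoot T (ContinuousLinearMap.adjoint A x)‖
      ≤ ‖ContinuousLinearMap.adjoint A‖ * ‖asymptoticRoot T x‖ := by
    intro x
    refine le_of_sq_le_sq ?_ (by positivity)
    rw [mul_pow]
    refine le_of_tendsto_of_tendsto' (hnorm _) ((hnorm x).const_mul _) fun k => ?_
    rw [hcomm, ← mul_pow]
    gcongr
    exact ContinuousLinearMap.le_opNorm _ _
  exact LinearMap.extendOfNorm_eq (f := ((toAsymptoticSpace T).comp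
    (ContinuousLinearMap.adjoint A)).toLinearMap) (e := (toAsymptoticSpace T).toLinearMap)
    (denseRange_toAsymptoticSpace T) ⟨_, hbound⟩ h

/-! ### The canonical `Γₙ`-unitary -/

/-- `W` on `K` is the minimal unitary extension of the isometry `V` on `E`, where `E` is identified
with a closed subspace of `K` through the isometric embedding `ι`: it is a unitary extension of `V`,
and `K` is the smallest closed reducing subspace for `W` containing `E`. -/
structure IsMinimalUnitaryExtension {E : Type*} [NormedAddCommGroup E] [InnerProductSpace ℂ E]
    (V : E →L[ℂ] E) (ι : E →ₗᵢ[ℂ] K) (W : K →L[ℂ] K) : Prop where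
  isUnitary : W ∈ unitary (K →L[ℂ] K)
  extension : ∀ x, W (ι x) = ι (V x)
  minimal : ∀ M : Submodule ℂ K, IsClosed (M : Set K) → (∀ x, ι x ∈ M) →
    (∀ y ∈ M, W y ∈ M) → (∀ y ∈ M, ContinuousLinearMap.adjoint W y ∈ M) → M = ⊤

/-- `(D₁, …, Dₙ)` on `K` is the canonical `Γₙ`-unitary associated with the `Γₙ`-contraction
`(S₁, …, Sₙ)`: it is a `Γₙ`-unitary, `(D₁*, …, Dₙ*)` extends the tuple of operators
`𝒫 h ↦ 𝒫 (Sᵢ* h)` on `closure (Ran 𝒫) ⊆ K`, and `Dₙ*` is the minimal unitary extension of the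
isometry `𝒫 h ↦ 𝒫 (Sₙ* h)`. The inclusion of `closure (Ran 𝒫)` into `K` is `ι`. -/
structure IsCanonicalGammaUnitary (hn : 2 ≤ n) (S : Fin n → H →L[ℂ] H)
    (ι : asymptoticSpace (S (lastIdx n hn)) →ₗᵢ[ℂ] K) (D : Fin n → K →L[ℂ] K) : Prop where
  isGammaUnitary : IsGammaUnitary D
  extension : ∀ i x, ContinuousLinearMap.adjoint (D i) (ι x)
    = ι (inducedAdjoint (S (lastIdx n hn)) (S i) x)
  minimal : IsMinimalUnitaryExtension
    (inducedAdjoint (S (lastIdx n hn)) (S (lastIdx n hn))) ι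
    (ContinuousLinearMap.adjoint (D (lastIdx n hn)))

/-- The tuples `T` and `T'` are unitarily equivalent through the unitary `U`. -/
def UnitarilyEquivalentVia (U : H ≃ₗᵢ[ℂ] K) (T : Fin n → H →L[ℂ] H) (T' : Fin n → K →L[ℂ] K) :
    Prop :=
  ∀ i h, U (T i h) = T' i (U h)

end GammaN

end

/-!
The extension `Dₙ*` of `Aₙ` is normal and minimal, so the vectors `Dₙᵏ x` with `x` in the closure of
`Ran 𝒫` span a dense subspace. Normality gives `⟪Dₙᵏ x, Dₙˡ y⟫ = ⟪Aₙˡ x, Aₙᵏ y⟫`: the Gram matrix of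
this family depends on `Aₙ` alone. Since `‖𝒫 h‖ = lim ‖(Sₙ*)ᵏ h‖`, the unitary `U` induces a unitary
between the closures of the ranges that intertwines the `Aᵢ`, hence one between the dilation spaces.
An operator `Dᵢ*` that commutes with `Dₙ*` also commutes with `Dₙ` (Fuglede), so it is determined on
the spanning family by `Aᵢ`.
-/

section Intertwining

theorem map_pow_apply_of_intertwines {R M M' : Type*} [Semiring R] [TopologicalSpace M]
    [AddCommMonoid M] [Module R M] [TopologicalSpace M'] [AddCommMonoid M'] [Module R M']
    {f : M → M'} {A : M →L[R] M} {A' : M' →L[R] M'} (h : ∀ x, f (A x) = A' (f x)) (k : ℕ) (x : M) :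
    f ((A ^ k) x) = (A' ^ k) (f x) := by
  induction k with
  | zero => rfl
  | succ k ih => rw [pow_succ', pow_succ', mul_apply_eq_comp, mul_apply_eq_comp, h, ih]

variable {𝕜 H H' : Type*} [RCLike 𝕜]
  [NormedAddCommGroup H] [InnerProductSpace 𝕜 H] [CompleteSpace H]
  [NormedAddCommGroup H'] [InnerProductSpace 𝕜 H'] [CompleteSpace H']
  {A : H →L[𝕜] H} {A' : H' →L[𝕜] H'}

theorem eq_conjStarAlgEquiv_of_intertwines (U : H ≃ₗᵢ[𝕜] H') (h : ∀ x, U (A x) = A' (U x)) :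
    A' = U.conjStarAlgEquiv A := by
  ext y
  rw [U.conjStarAlgEquiv_apply_apply, h, U.apply_symm_apply]

theorem map_adjoint_apply_of_intertwines (U : H ≃ₗᵢ[𝕜] H') (h : ∀ x, U (A x) = A' (U x)) (x : H) :
    U ((A†) x) = (A'†) (U x) := by
  rw [eq_conjStarAlgEquiv_of_intertwines U h,
    ← ContinuousLinearMap.star_eq_adjoint (_ : H' →L[𝕜] H'), ← map_star,
    U.conjStarAlgEquiv_apply_apply, U.symm_apply_apply, ContinuousLinearMap.star_eq_adjoint]

end Intertwining

theorem exists_linearIsometryEquiv_of_inner_eq {𝕜 α K K' : Type*} [RCLike 𝕜]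
    [NormedAddCommGroup K] [InnerProductSpace 𝕜 K] [CompleteSpace K]
    [NormedAddCommGroup K'] [InnerProductSpace 𝕜 K'] [CompleteSpace K'] {v : α → K} {v' : α → K'}
    (hv : Dense (Submodule.span 𝕜 (Set.range v) : Set K))
    (hv' : Dense (Submodule.span 𝕜 (Set.range v') : Set K'))
    (hinner : ∀ a b, inner 𝕜 (v' a) (v' b) = inner 𝕜 (v a) (v b)) :
    ∃ W : K ≃ₗᵢ[𝕜] K', ∀ a, W (v a) = v' a := by
  have hdense : DenseRange (Finsupp.linearCombination 𝕜 v) := by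
    rwa [DenseRange, ← LinearMap.coe_range, Finsupp.range_linearCombination]
  have hdense' : DenseRange (Finsupp.linearCombination 𝕜 v') := by
    rwa [DenseRange, ← LinearMap.coe_range, Finsupp.range_linearCombination]
  have hnorm : ∀ c : α →₀ 𝕜,
      ‖Finsupp.linearCombination 𝕜 v' c‖ = ‖Finsupp.linearCombination 𝕜 v c‖ := by
    intro c
    simp only [norm_eq_sqrt_re_inner (𝕜 := 𝕜), Finsupp.linearCombination_apply, Finsupp.sum,
      sum_inner, inner_sum, inner_smul_left, inner_smul_right, hinner]
  refine ⟨(LinearEquiv.refl 𝕜 (α →₀ 𝕜)).extendOfIsometry _ _ hdense hdense' hnorm, fun a => ?_⟩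
  simpa using (LinearEquiv.refl 𝕜 (α →₀ 𝕜)).extendOfIsometry_eq _ _ hdense hdense' hnorm
    (Finsupp.single a 1)

theorem inner_adjoint_pow_apply_adjoint_pow_apply {𝕜 K : Type*} [RCLike 𝕜] [NormedAddCommGroup K]
    [InnerProductSpace 𝕜 K] [CompleteSpace K] {N : K →L[𝕜] K} (hN : IsStarNormal N) (k l : ℕ)
    (x y : K) :
    inner 𝕜 ((N† ^ k) x) ((N† ^ l) y) = inner 𝕜 ((N ^ l) x) ((N ^ k) y) := by
  have hadj (m : ℕ) : N† ^ m = (N ^ m)† := by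
    simp only [← ContinuousLinearMap.star_eq_adjoint, star_pow]
  have hcomm : (N ^ l) ((N† ^ k) x) = (N† ^ k) ((N ^ l) x) := by
    rw [← mul_apply_eq_comp, ← mul_apply_eq_comp, ← ContinuousLinearMap.star_eq_adjoint,
      (hN.star_comm_self.pow_pow k l).eq]
  rw [hadj l, ContinuousLinearMap.adjoint_inner_right, hcomm, hadj k,
    ContinuousLinearMap.adjoint_inner_left]

namespace GammaN

section NormalExtension

variable {E : Type*} [NormedAddCommGroup E] [InnerProductSpace ℂ E]
  {E' : Type*} [NormedAddCommGroup E'] [InnerProductSpace ℂ E']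
  {K : Type*} [NormedAddCommGroup K] [InnerProductSpace ℂ K] [CompleteSpace K]
  {K' : Type*} [NormedAddCommGroup K'] [InnerProductSpace ℂ K'] [CompleteSpace K']

/-- `N` on `K` is the minimal normal extension of the (subnormal) operator `C` on `E`: the analogue
of `IsMinimalUnitaryExtension` with "normal" in place of "unitary". As there, `E` is identified with
a subspace of `K` through `ι`, and minimality refers to closed subspaces reducing `N`. -/
structure IsMinimalNormalExtension (C : E →L[ℂ] E) (ι : E →ₗᵢ[ℂ] K) (N : K →L[ℂ] K) : Prop where
  isStarNormal : IsStarNormal N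
  extension : ∀ x, N (ι x) = ι (C x)
  minimal : ∀ M : Submodule ℂ K, IsClosed (M : Set K) → (∀ x, ι x ∈ M) →
    (∀ y ∈ M, N y ∈ M) → (∀ y ∈ M, (N†) y ∈ M) → M = ⊤

theorem IsMinimalUnitaryExtension.isMinimalNormalExtension {C : E →L[ℂ] E} {ι : E →ₗᵢ[ℂ] K}
    {W : K →L[ℂ] K} (hW : IsMinimalUnitaryExtension C ι W) : IsMinimalNormalExtension C ι W :=
  ⟨isStarNormal_of_mem_unitary hW.isUnitary, hW.extension, hW.minimal⟩

namespace IsMinimalNormalExtension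

variable {C : E →L[ℂ] E} {ι : E →ₗᵢ[ℂ] K} {N : K →L[ℂ] K}
  {C' : E' →L[ℂ] E'} {ι' : E' →ₗᵢ[ℂ] K'} {N' : K' →L[ℂ] K'}

theorem inner_adjoint_pow_embedding (hN : IsMinimalNormalExtension C ι N) (k l : ℕ) (x y : E) :
    inner ℂ ((N† ^ k) (ι x)) ((N† ^ l) (ι y)) = inner ℂ ((C ^ l) x) ((C ^ k) y) := by
  rw [inner_adjoint_pow_apply_adjoint_pow_apply hN.isStarNormal,
    ← map_pow_apply_of_intertwines fun z => (hN.extension z).symm,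
    ← map_pow_apply_of_intertwines fun z => (hN.extension z).symm, ι.inner_map_map]

theorem apply_adjoint_pow_embedding (hN : IsMinimalNormalExtension C ι N) {B : K →L[ℂ] K}
    {A : E →L[ℂ] E} (hB : Commute B N) (hBA : ∀ x, B (ι x) = ι (A x)) (k : ℕ) (x : E) :
    B ((N† ^ k) (ι x)) = (N† ^ k) (ι (A x)) := by
  have hcomm : Commute B (N† ^ k) := (hN.isStarNormal.commute_star_right hB).pow_right k
  rw [← hBA, ← mul_apply_eq_comp, ← mul_apply_eq_comp, hcomm.eq]

theorem dense_span_adjoint_pow_embedding (hN : IsMinimalNormalExtension C ι N) :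
    Dense (Submodule.span ℂ (Set.range fun p : ℕ × E => (N† ^ p.1) (ι p.2)) : Set K) := by
  set orbit := Set.range fun p : ℕ × E => (N† ^ p.1) (ι p.2)
  have hN_orbit : Set.MapsTo N orbit orbit := by
    rintro _ ⟨⟨k, x⟩, rfl⟩
    exact ⟨(k, C x), (hN.apply_adjoint_pow_embedding (Commute.refl N) hN.extension k x).symm⟩
  have hadj_orbit : Set.MapsTo (N†) orbit orbit := by
    rintro _ ⟨⟨k, x⟩, rfl⟩
    exact ⟨(k + 1, x), by simp only [pow_succ', mul_apply_eq_comp]⟩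
  have hinvariant (A : K →L[ℂ] K) (hA : Set.MapsTo A orbit orbit) :
      ∀ y ∈ (Submodule.span ℂ orbit).topologicalClosure,
        A y ∈ (Submodule.span ℂ orbit).topologicalClosure :=
    (Set.MapsTo.submoduleSpan (f := A.toLinearMap) hA).closure A.continuous
  rw [Submodule.dense_iff_topologicalClosure_eq_top]
  refine hN.minimal _ (Submodule.isClosed_topologicalClosure _) (fun x => ?_)
    (hinvariant N hN_orbit) (hinvariant (N†) hadj_orbit)
  exact Submodule.le_topologicalClosure _ (Submodule.subset_span ⟨(0, x), rfl⟩)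

theorem continuousLinearMap_ext (hN : IsMinimalNormalExtension C ι N) {α F : Type*}
    [TopologicalSpace F] [AddCommMonoid F] [Module ℂ F] [T2Space F] {e : α → E}
    (he : DenseRange e) {A B : K →L[ℂ] F}
    (hAB : ∀ (k : ℕ) (a : α), A ((N† ^ k) (ι (e a))) = B ((N† ^ k) (ι (e a)))) : A = B := by
  have horbit (k : ℕ) (x : E) : A ((N† ^ k) (ι x)) = B ((N† ^ k) (ι x)) :=
    he.induction_on x (isClosed_eq (by fun_prop) (by fun_prop)) (hAB k)
  refine ContinuousLinearMap.ext_on hN.dense_span_adjoint_pow_embedding ?_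
  rintro _ ⟨⟨k, x⟩, rfl⟩
  exact horbit k x

theorem exists_linearIsometryEquiv (hN : IsMinimalNormalExtension C ι N)
    (hN' : IsMinimalNormalExtension C' ι' N') (Φ : E ≃ₗᵢ[ℂ] E') (hΦ : ∀ x, Φ (C x) = C' (Φ x)) :
    ∃ W : K ≃ₗᵢ[ℂ] K', ∀ (k : ℕ) (x : E), W ((N† ^ k) (ι x)) = (N'† ^ k) (ι' (Φ x)) := by
  have hspan' : Dense (Submodule.span ℂ
      (Set.range fun p : ℕ × E => (N'† ^ p.1) (ι' (Φ p.2))) : Set K') := by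
    have hsurj : Function.Surjective (Prod.map id Φ : ℕ × E → ℕ × E') :=
      Function.surjective_id.prodMap Φ.surjective
    have hdense := hN'.dense_span_adjoint_pow_embedding
    rwa [← hsurj.range_comp] at hdense
  obtain ⟨W, hW⟩ := exists_linearIsometryEquiv_of_inner_eq hN.dense_span_adjoint_pow_embedding
    hspan' fun p q => by
      rw [hN'.inner_adjoint_pow_embedding, hN.inner_adjoint_pow_embedding,
        ← map_pow_apply_of_intertwines hΦ, ← map_pow_apply_of_intertwines hΦ, Φ.inner_map_map]
  exact ⟨W, fun k x => hW (k, x)⟩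

theorem intertwines_of_commute (hN : IsMinimalNormalExtension C ι N)
    (hN' : IsMinimalNormalExtension C' ι' N') {Φ : E → E'} {W : K →L[ℂ] K'}
    (hW : ∀ (k : ℕ) (x : E), W ((N† ^ k) (ι x)) = (N'† ^ k) (ι' (Φ x)))
    {A : E →L[ℂ] E} {A' : E' →L[ℂ] E'} (hΦ : ∀ x, Φ (A x) = A' (Φ x))
    {B : K →L[ℂ] K} (hB : Commute B N) (hBA : ∀ x, B (ι x) = ι (A x))
    {B' : K' →L[ℂ] K'} (hB' : Commute B' N') (hBA' : ∀ x, B' (ι' x) = ι' (A' x)) (y : K) :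
    W (B y) = B' (W y) := by
  suffices hcomp : W ∘L B = B' ∘L W from DFunLike.congr_fun hcomp y
  refine hN.continuousLinearMap_ext denseRange_id fun k x => ?_
  rw [ContinuousLinearMap.comp_apply, ContinuousLinearMap.comp_apply,
    id_eq, hN.apply_adjoint_pow_embedding hB hBA, hW, hW,
    hN'.apply_adjoint_pow_embedding hB' hBA', hΦ]

end IsMinimalNormalExtension

end NormalExtension

section AsymptoticSpace

variable {H : Type*} [NormedAddCommGroup H] [InnerProductSpace ℂ H] [CompleteSpace H]
  {H' : Type*} [NormedAddCommGroup H'] [InnerProductSpace ℂ H'] [CompleteSpace H']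
  {T : H →L[ℂ] H} {T' : H' →L[ℂ] H'}

theorem tendsto_norm_adjoint_pow_apply_sq (hT : ‖T‖ ≤ 1) (x : H) :
    Tendsto (fun k : ℕ => ‖(T† ^ k) x‖ ^ 2) atTop (𝓝 (‖toAsymptoticSpace T x‖ ^ 2)) := by
  obtain ⟨hpos, hlim⟩ := asymptoticRoot_spec T hT
  have hroot : RCLike.re (inner ℂ (asymptoticRoot T (asymptoticRoot T x)) x)
      = ‖toAsymptoticSpace T x‖ ^ 2 := by
    rw [hpos.inner_left_eq_inner_right]
    exact inner_self_eq_norm_sq (𝕜 := ℂ) _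
  have hpow (k : ℕ) : RCLike.re (inner ℂ ((T ^ k * T† ^ k) x) x) = ‖(T† ^ k) x‖ ^ 2 := by
    have hadj : T ^ k = (T† ^ k)† := by
      simp only [← ContinuousLinearMap.star_eq_adjoint, star_pow, star_star]
    rw [mul_apply_eq_comp, hadj, ContinuousLinearMap.adjoint_inner_left]
    exact inner_self_eq_norm_sq (𝕜 := ℂ) _
  rw [← hroot]
  exact ((RCLike.continuous_re.tendsto _).comp ((hlim x).inner tendsto_const_nhds)).congr hpow

theorem norm_toAsymptoticSpace_map (hT : ‖T‖ ≤ 1) (hT' : ‖T'‖ ≤ 1) (U : H ≃ₗᵢ[ℂ] H')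
    (hU : ∀ x, U (T x) = T' (U x)) (x : H) :
    ‖toAsymptoticSpace T' (U x)‖ = ‖toAsymptoticSpace T x‖ := by
  have hpow (k : ℕ) : ‖(T† ^ k) x‖ ^ 2 = ‖(T'† ^ k) (U x)‖ ^ 2 := by
    rw [← map_pow_apply_of_intertwines (map_adjoint_apply_of_intertwines U hU), U.norm_map]
  have hsq : ‖toAsymptoticSpace T' (U x)‖ ^ 2 = ‖toAsymptoticSpace T x‖ ^ 2 :=
    tendsto_nhds_unique (tendsto_norm_adjoint_pow_apply_sq hT' (U x))
      ((tendsto_norm_adjoint_pow_apply_sq hT x).congr hpow)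
  exact (sq_eq_sq₀ (norm_nonneg _) (norm_nonneg _)).mp hsq

theorem exists_asymptoticSpace_linearIsometryEquiv (hT : ‖T‖ ≤ 1) (hT' : ‖T'‖ ≤ 1)
    (U : H ≃ₗᵢ[ℂ] H') (hU : ∀ x, U (T x) = T' (U x)) :
    ∃ Φ : asymptoticSpace T ≃ₗᵢ[ℂ] asymptoticSpace T',
      ∀ h, Φ (toAsymptoticSpace T h) = toAsymptoticSpace T' (U h) :=
  ⟨U.toLinearEquiv.extendOfIsometry (toAsymptoticSpace T).toLinearMap
      (toAsymptoticSpace T').toLinearMap (denseRange_toAsymptoticSpace T)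
      (denseRange_toAsymptoticSpace T') (norm_toAsymptoticSpace_map hT hT' U hU),
    U.toLinearEquiv.extendOfIsometry_eq _ _ _ _ _⟩

theorem map_inducedAdjoint_of_intertwines (hT : ‖T‖ ≤ 1) (hT' : ‖T'‖ ≤ 1) {A : H →L[ℂ] H}
    {A' : H' →L[ℂ] H'} (hA : Commute A T) (hA' : Commute A' T') (U : H ≃ₗᵢ[ℂ] H')
    (hU : ∀ x, U (A x) = A' (U x)) {Φ : asymptoticSpace T →L[ℂ] asymptoticSpace T'}
    (hΦ : ∀ h, Φ (toAsymptoticSpace T h) = toAsymptoticSpace T' (U h)) (x : asymptoticSpace T) :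
    Φ (inducedAdjoint T A x) = inducedAdjoint T' A' (Φ x) := by
  refine (denseRange_toAsymptoticSpace T).induction_on x
    (isClosed_eq (by fun_prop) (by fun_prop)) fun h => ?_
  rw [inducedAdjoint_apply T A hT hA, hΦ, hΦ, inducedAdjoint_apply T' A' hT' hA',
    map_adjoint_apply_of_intertwines U hU]

end AsymptoticSpace

end GammaN

open GammaN in
theorem theorem2p6_general {I : Type*} (j : I)
    {H : Type*} [NormedAddCommGroup H] [InnerProductSpace ℂ H] [CompleteSpace H]
    {H' : Type*} [NormedAddCommGroup H'] [InnerProductSpace ℂ H'] [CompleteSpace H']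
    {K : Type*} [NormedAddCommGroup K] [InnerProductSpace ℂ K] [CompleteSpace K]
    {K' : Type*} [NormedAddCommGroup K'] [InnerProductSpace ℂ K'] [CompleteSpace K']
    {S : I → H →L[ℂ] H} {S' : I → H' →L[ℂ] H'} (hSj : ‖S j‖ ≤ 1) (hS : ∀ i, Commute (S i) (S j))
    {ι : asymptoticSpace (S j) →ₗᵢ[ℂ] K} {D : I → K →L[ℂ] K} (hD : ∀ i, Commute (D i) (D j))
    (hDext : ∀ i x, (D i†) (ι x) = ι (inducedAdjoint (S j) (S i) x))
    (hDmin : IsMinimalNormalExtension (inducedAdjoint (S j) (S j)) ι (D j†))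
    {ι' : asymptoticSpace (S' j) →ₗᵢ[ℂ] K'} {D' : I → K' →L[ℂ] K'}
    (hD' : ∀ i, Commute (D' i) (D' j))
    (hDext' : ∀ i x, (D' i†) (ι' x) = ι' (inducedAdjoint (S' j) (S' i) x))
    (hDmin' : IsMinimalNormalExtension (inducedAdjoint (S' j) (S' j)) ι' (D' j†))
    (U : H ≃ₗᵢ[ℂ] H') (hU : ∀ i h, U (S i h) = S' i (U h)) :
    ∃ UD : K ≃ₗᵢ[ℂ] K',
      (∀ (k : ℕ) (h : H), UD ((D j ^ k) (ι (toAsymptoticSpace (S j) h)))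
        = (D' j ^ k) (ι' (toAsymptoticSpace (S' j) (U h)))) ∧
      (∀ W : K →L[ℂ] K',
        (∀ (k : ℕ) (h : H), W ((D j ^ k) (ι (toAsymptoticSpace (S j) h)))
          = (D' j ^ k) (ι' (toAsymptoticSpace (S' j) (U h)))) →
        ∀ x, W x = UD x) ∧
      ∀ i x, UD (D i x) = D' i (UD x) := by
  have hconj (i : I) : S' i = U.conjStarAlgEquiv (S i) :=
    eq_conjStarAlgEquiv_of_intertwines U (hU i)
  have hSj' : ‖S' j‖ ≤ 1 := by rwa [hconj, StarAlgEquiv.norm_map]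
  have hS' (i : I) : Commute (S' i) (S' j) := by
    rw [hconj i, hconj j]
    exact (hS i).map U.conjStarAlgEquiv
  obtain ⟨Φ, hΦ⟩ := exists_asymptoticSpace_linearIsometryEquiv hSj hSj' U (hU j)
  have hΦ_induced (i : I) (x : asymptoticSpace (S j)) :
      Φ (inducedAdjoint (S j) (S i) x) = inducedAdjoint (S' j) (S' i) (Φ x) :=
    map_inducedAdjoint_of_intertwines (Φ := (Φ : _ →L[ℂ] _)) hSj hSj' (hS i) (hS' i) U (hU i) hΦ x
  obtain ⟨UD, hUD⟩ := hDmin.exists_linearIsometryEquiv hDmin' Φ (hΦ_induced j)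
  have hUD_adjoint (i : I) (x : K) : UD ((D i†) x) = (D' i†) (UD x) :=
    hDmin.intertwines_of_commute (W := (UD : K →L[ℂ] K')) hDmin' hUD (hΦ_induced i)
      (hD i).star_star (hDext i) (hD' i).star_star (hDext' i) x
  simp only [ContinuousLinearMap.adjoint_adjoint] at hUD
  refine ⟨UD, fun k h => by rw [hUD, hΦ], fun W hW x => ?_, fun i x => ?_⟩
  · suffices h : W = (UD : K →L[ℂ] K') from DFunLike.congr_fun h x
    refine hDmin.continuousLinearMap_ext (denseRange_toAsymptoticSpace (S j)) fun k h => ?_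
    rw [ContinuousLinearMap.adjoint_adjoint, hW, ← hΦ]
    exact (hUD k _).symm
  · simpa only [ContinuousLinearMap.adjoint_adjoint] using
      map_adjoint_apply_of_intertwines UD (hUD_adjoint i) x

theorem theorem2p6 {n : ℕ} (hn : 2 ≤ n)
    {H : Type*} [NormedAddCommGroup H] [InnerProductSpace ℂ H] [CompleteSpace H]
    {H' : Type*} [NormedAddCommGroup H'] [InnerProductSpace ℂ H'] [CompleteSpace H']
    {K : Type*} [NormedAddCommGroup K] [InnerProductSpace ℂ K] [CompleteSpace K]
    {K' : Type*} [NormedAddCommGroup K'] [InnerProductSpace ℂ K'] [CompleteSpace K']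
    (S : Fin n → H →L[ℂ] H) (S' : Fin n → H' →L[ℂ] H')
    (hS : GammaN.IsGammaContraction S) (hS' : GammaN.IsGammaContraction S')
    (ι : GammaN.asymptoticSpace (S (GammaN.lastIdx n hn)) →ₗᵢ[ℂ] K) (D : Fin n → K →L[ℂ] K)
    (hD : GammaN.IsCanonicalGammaUnitary hn S ι D)
    (ι' : GammaN.asymptoticSpace (S' (GammaN.lastIdx n hn)) →ₗᵢ[ℂ] K') (D' : Fin n → K' →L[ℂ] K')
    (hD' : GammaN.IsCanonicalGammaUnitary hn S' ι' D')
    (U : H ≃ₗᵢ[ℂ] H') (hU : GammaN.UnitarilyEquivalentVia U S S') :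
    ∃ UD : K ≃ₗᵢ[ℂ] K',
      (∀ (k : ℕ) (h : H),
        UD ((D (GammaN.lastIdx n hn) ^ k)
            (ι (GammaN.toAsymptoticSpace (S (GammaN.lastIdx n hn)) h)))
          = (D' (GammaN.lastIdx n hn) ^ k)
            (ι' (GammaN.toAsymptoticSpace (S' (GammaN.lastIdx n hn)) (U h)))) ∧
      (∀ W : K →L[ℂ] K',
        (∀ (k : ℕ) (h : H),
          W ((D (GammaN.lastIdx n hn) ^ k)
              (ι (GammaN.toAsymptoticSpace (S (GammaN.lastIdx n hn)) h)))
            = (D' (GammaN.lastIdx n hn) ^ k)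
              (ι' (GammaN.toAsymptoticSpace (S' (GammaN.lastIdx n hn)) (U h)))) →
        ∀ x, W x = UD x) ∧
      GammaN.UnitarilyEquivalentVia UD D D' := by
  exact theorem2p6_general (GammaN.lastIdx n hn) (hS.norm_last_le_one hn) (fun i => hS.commute i _)
    (fun i => hD.isGammaUnitary.commute i _) hD.extension hD.minimal.isMinimalNormalExtension
    (fun i => hD'.isGammaUnitary.commute i _) hD'.extension hD'.minimal.isMinimalNormalExtension
    U hU
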